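/- Let $A_1,\dots,A_m,B$ be real symmetric $n\times n$ matrices, write $S\bullet T=\sum_{i,j}s_{ij}t_{ij}$, let $S\preceq T$ mean that $T-S$ is positive semidefinite, and assume that the semidefinite system $$P_{SD}=\Big\{x\in\mathbb R^m : \sum_{i=1}^m x_iA_i\preceq B\Big\}$$ is nonempty. A slack of $P_{SD}$ is a matrix $B-\sum_i x_iA_i$ with $x\in P_{SD}$. Call $P_{SD}$ well-behaved if for every $c\in\mathbb R^m$ for which $v=\sup\{\sum_i c_ix_i : x\in P_{SD}\}$ is finite, there is a $Y\succeq 0$ with $A_i\bullet Y=c_i$ for $i=1,\dots,m$ and $B\bullet Y=v$. For an invertible $n\times n$ matrix $T$, the rotated system is obtained by replacing every $A_i$ by $T^TA_iT$ and $B$ by $T^TBT$. There are an $r\in\{0,\dots,n\}$ and an invertible $T$ such that the rotated system has the maximum rank slack $Z=\begin{pmatrix}I_r&0\\0&0\end{pmatrix}$. For all such $r$ and $T$ (in particular for $T=I_n$, if $Z$ is already a maximum rank slack of $P_{SD}$), the system $P_{SD}$ is well-behaved if and only if there is an invertible matrix $P$ of order $n-r$ such that, after the further rotation by $I_r\oplus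 P$ (that is, with $A_i'=(T(I_r\oplus P))^TA_i\,T(I_r\oplus P)$ and $B'=(T(I_r\oplus P))^TB\,T(I_r\oplus P)$), the following two conditions hold: 1. the matrix $U=\begin{pmatrix}0&0\\0&I_{n-r}\end{pmatrix}$ satisfies $A_1'\bullet U=\dots=A_m'\bullet U=B'\bullet U=0$; 2. every linear combination $V$ of $A_1',\dots,A_m',B'$ of the form $V=\begin{pmatrix}V_{11}&V_{12}\\V_{12}^T&0\end{pmatrix}$, with $V_{11}$ symmetric of order $r$, has $V_{12}=0$. -/

import Mathlib

open scoped Matrix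

/-- The inner product `S • T = ∑ i j, s_ij t_ij` of matrices. -/
def frob {n : ℕ} (S T : Matrix (Fin n) (Fin n) ℝ) : ℝ :=
  ∑ i, ∑ j, S i j * T i j

/-- The slack `B - ∑ x_i A_i` of the point `x`. -/
def slackAt {m n : ℕ} (A : Fin m → Matrix (Fin n) (Fin n) ℝ) (B : Matrix (Fin n) (Fin n) ℝ)
    (x : Fin m → ℝ) : Matrix (Fin n) (Fin n) ℝ :=
  B - ∑ i, x i • A i

/-- The semidefinite system: the set of all `x` with `∑ x_i A_i ⪯ B`. -/
def sdSystem {m n : ℕ} (A : Fin m → Matrix (Fin n) (Fin n) ℝ)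
    (B : Matrix (Fin n) (Fin n) ℝ) : Set (Fin m → ℝ) :=
  {x | (slackAt A B x).PosSemidef}

/-- The system is well-behaved: for every objective `c` for which the value `v` of the primal
problem `sup {∑ c_i x_i | ∑ x_i A_i ⪯ B}` is finite, the dual problem
`inf {B • Y | Y ⪰ 0, A_i • Y = c_i}` has a feasible solution with value `v`.
(A set of reals has a real least upper bound exactly when it is nonempty and bounded above.) -/
def WellBehaved {m n : ℕ} (A : Fin m → Matrix (Fin n) (Fin n) ℝ)
    (B : Matrix (Fin n) (Fin n) ℝ) : Prop :=
  ∀ (c : Fin m → ℝ) (v : ℝ), IsLUB ((fun x => ∑ i, c i * x i) '' sdSystem A B) v →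
    ∃ Y : Matrix (Fin n) (Fin n) ℝ,
      Y.PosSemidef ∧ (∀ i, frob (A i) Y = c i) ∧ frob B Y = v

/-- `Z` is a slack of the system, and no slack has larger rank. -/
def IsMaxRankSlack {m n : ℕ} (A : Fin m → Matrix (Fin n) (Fin n) ℝ)
    (B Z : Matrix (Fin n) (Fin n) ℝ) : Prop :=
  (∃ x ∈ sdSystem A B, slackAt A B x = Z) ∧
    ∀ x ∈ sdSystem A B, (slackAt A B x).rank ≤ Z.rank

/-- The rotation `Tᵀ M T` of `M` by `T`. -/
def rotate {n : ℕ} (T M : Matrix (Fin n) (Fin n) ℝ) : Matrix (Fin n) (Fin n) ℝ :=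
  Tᵀ * M * T

/-- The `n × n` matrix `I_r ⊕ 0`. -/
def leadingId (n r : ℕ) : Matrix (Fin n) (Fin n) ℝ :=
  Matrix.diagonal fun i => if (i : ℕ) < r then 1 else 0

/-- The `n × n` matrix `0 ⊕ I_{n-r}`. -/
def trailingId (n r : ℕ) : Matrix (Fin n) (Fin n) ℝ :=
  Matrix.diagonal fun i => if (i : ℕ) < r then 0 else 1

/-- `Q = I_r ⊕ P` with `P` an invertible matrix of order `n - r`. -/
def IsTrailingRotation {n : ℕ} (r : ℕ) (Q : Matrix (Fin n) (Fin n) ℝ) : Prop :=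
  IsUnit Q ∧ ∀ i j : Fin n, (i : ℕ) < r ∨ (j : ℕ) < r →
    Q i j = (1 : Matrix (Fin n) (Fin n) ℝ) i j

/-- `U = 0 ⊕ I_{n-r}` satisfies `A_1 • U = ⋯ = A_m • U = B • U = 0`. -/
def OrthogonalityCondition {m n : ℕ} (r : ℕ) (A : Fin m → Matrix (Fin n) (Fin n) ℝ)
    (B : Matrix (Fin n) (Fin n) ℝ) : Prop :=
  (∀ i, frob (A i) (trailingId n r) = 0) ∧ frob B (trailingId n r) = 0

/-- Every linear combination `V` of the `A_i` and `B` whose lower right block of order `n - r`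
is zero has zero upper right `r × (n - r)` block. -/
def BlockCondition {m n : ℕ} (r : ℕ) (A : Fin m → Matrix (Fin n) (Fin n) ℝ)
    (B : Matrix (Fin n) (Fin n) ℝ) : Prop :=
  ∀ V ∈ Submodule.span ℝ (insert B (Set.range A)),
    (∀ i j : Fin n, r ≤ (i : ℕ) → r ≤ (j : ℕ) → V i j = 0) →
      ∀ i j : Fin n, (i : ℕ) < r → r ≤ (j : ℕ) → V i j = 0

/-! ### The trace inner product and positive semidefinite matrices -/

section Frobenius

variable {n : ℕ}

/-! Write `E = I_r ⊕ 0`, `F = 0 ⊕ I` and `L x = ∑ x_i A_i`, after rotating so that `E` is a maximum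
rank slack, say at `z`; then `B = E + L z`. Averaging a slack with `E` shows that every slack `S`
satisfies `S F = 0` (`IsMaxRankSlack.slackAt_mul_trailingId`).

Necessity. Suppose `F (L x) F ⪰ 0` but `L x F ≠ 0`. A functional that is `-1` at `x` and zero on `{y
| L y F = 0}` is constant on the feasible set, so its supremum is finite. A dual solution `Y` then
has `E • Y = 0`, hence lives on the trailing block, and `-1 = L x • Y = F (L x) F • Y ≥ 0`, which is
absurd. Zero trailing blocks give the block condition. Otherwise no nonzero trailing block is
semidefinite, and separation from the trace-one semidefinite matrices gives an `H`, positive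
definite on the trailing block and orthogonal to all `L x`; a rotation turns `H` into `U`.

Sufficiency. The block condition makes `L x` live on the leading block whenever `F (L x) F = 0`, and
feasible points differ only by such `x`. The reduced problem has the Slater slack `I_r`, so its dual
is attained (`exists_leading_dual_solution`). Off this subspace the solution is corrected by a
trailing block, made semidefinite by adding a multiple of `U`, which the orthogonality condition
makes free. -/

lemma frob_eq_trace (S T : Matrix (Fin n) (Fin n) ℝ) : frob S T = (S * Tᵀ).trace := by
  simp [frob, Matrix.trace, Matrix.mul_apply]

lemma frob_comm (S T : Matrix (Fin n) (Fin n) ℝ) : frob S T = frob T S := by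
  simp [frob, mul_comm]

/-- The linear functional `S ↦ S • T`. -/
def frobLin (T : Matrix (Fin n) (Fin n) ℝ) : Matrix (Fin n) (Fin n) ℝ →ₗ[ℝ] ℝ where
  toFun S := frob S T
  map_add' S S' := by simp [frob, add_mul, Finset.sum_add_distrib]
  map_smul' a S := by simp [frob, Finset.mul_sum, mul_assoc]

@[simp] lemma frobLin_apply (S T : Matrix (Fin n) (Fin n) ℝ) : frobLin T S = frob S T := rfl

lemma frob_add_left (S S' T : Matrix (Fin n) (Fin n) ℝ) :
    frob (S + S') T = frob S T + frob S' T := (frobLin T).map_add S S'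

lemma frob_sub_left (S S' T : Matrix (Fin n) (Fin n) ℝ) :
    frob (S - S') T = frob S T - frob S' T := (frobLin T).map_sub S S'

lemma frob_smul_left (a : ℝ) (S T : Matrix (Fin n) (Fin n) ℝ) :
    frob (a • S) T = a * frob S T := (frobLin T).map_smul a S

lemma frob_zero_left (T : Matrix (Fin n) (Fin n) ℝ) : frob 0 T = 0 := (frobLin T).map_zero

lemma frob_add_right (S T T' : Matrix (Fin n) (Fin n) ℝ) :
    frob S (T + T') = frob S T + frob S T' := by
  simp only [frob_comm S, frob_add_left]

lemma frob_smul_right (a : ℝ) (S T : Matrix (Fin n) (Fin n) ℝ) :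
    frob S (a • T) = a * frob S T := by
  simp only [frob_comm S, frob_smul_left]

lemma frob_transpose (S T : Matrix (Fin n) (Fin n) ℝ) : frob Sᵀ Tᵀ = frob S T := by
  simp only [frob, Matrix.transpose_apply]
  exact Finset.sum_comm

lemma frob_mul_mul_left (P S R T : Matrix (Fin n) (Fin n) ℝ) :
    frob (P * S * R) T = frob S (Pᵀ * T * Rᵀ) := by
  simp only [frob_eq_trace, Matrix.transpose_mul, Matrix.transpose_transpose]
  rw [Matrix.mul_assoc, Matrix.mul_assoc, Matrix.trace_mul_comm]
  simp only [Matrix.mul_assoc]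

lemma frob_rotate (P S T : Matrix (Fin n) (Fin n) ℝ) :
    frob (rotate P S) T = frob S (P * T * Pᵀ) := by
  rw [rotate, frob_mul_mul_left, Matrix.transpose_transpose]

lemma frob_vecMulVec (x : Fin n → ℝ) (T : Matrix (Fin n) (Fin n) ℝ) :
    frob (Matrix.vecMulVec x x) T = x ⬝ᵥ T *ᵥ x := by
  simp only [frob, Matrix.vecMulVec_apply, dotProduct, Matrix.mulVec, Finset.mul_sum]
  exact Finset.sum_congr rfl fun i _ => Finset.sum_congr rfl fun j _ => by ring

/-- Every linear functional on matrices is represented by a matrix. -/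
lemma exists_frob_eq (g : Matrix (Fin n) (Fin n) ℝ →ₗ[ℝ] ℝ) :
    ∃ G : Matrix (Fin n) (Fin n) ℝ, ∀ M, g M = frob M G := by
  refine ⟨fun i j => g (Matrix.single i j 1), fun M => ?_⟩
  conv_lhs => rw [Matrix.matrix_eq_sum_single M]
  simp only [map_sum, frob]
  refine Finset.sum_congr rfl fun i _ => Finset.sum_congr rfl fun j _ => ?_
  rw [← mul_one (M i j), ← smul_eq_mul, ← Matrix.smul_single, map_smul]
  simp

/-- On symmetric matrices every linear functional is represented by a symmetric matrix. -/
lemma exists_isSymm_frob_eq (g : Matrix (Fin n) (Fin n) ℝ →ₗ[ℝ] ℝ) :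
    ∃ G : Matrix (Fin n) (Fin n) ℝ, G.IsSymm ∧ ∀ M, M.IsSymm → g M = frob M G := by
  obtain ⟨G, hG⟩ := exists_frob_eq g
  refine ⟨(1 / 2 : ℝ) • (G + Gᵀ), ?_, fun M hM => ?_⟩
  · simp [Matrix.IsSymm, add_comm]
  · have h : frob M Gᵀ = frob M G := by rw [← frob_transpose M G, hM.eq]
    rw [frob_smul_right, frob_add_right, h, hG]
    ring

lemma posSemidef_iff_real {M : Matrix (Fin n) (Fin n) ℝ} :
    M.PosSemidef ↔ M.IsSymm ∧ ∀ x : Fin n → ℝ, 0 ≤ x ⬝ᵥ M *ᵥ x := by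
  rw [Matrix.posSemidef_iff_dotProduct_mulVec]
  simp [Matrix.IsHermitian, Matrix.IsSymm]

lemma Matrix.PosSemidef.isSymm {M : Matrix (Fin n) (Fin n) ℝ} (hM : M.PosSemidef) : M.IsSymm :=
  (posSemidef_iff_real.1 hM).1

lemma Matrix.PosSemidef.rotate {M : Matrix (Fin n) (Fin n) ℝ} (hM : M.PosSemidef)
    (P : Matrix (Fin n) (Fin n) ℝ) : (rotate P M).PosSemidef := by
  simpa [_root_.rotate] using hM.conjTranspose_mul_mul_same P

lemma Matrix.IsSymm.rotate {M : Matrix (Fin n) (Fin n) ℝ} (hM : M.IsSymm)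
    (P : Matrix (Fin n) (Fin n) ℝ) : (rotate P M).IsSymm := by
  simp [_root_.rotate, Matrix.IsSymm, Matrix.transpose_mul, hM.eq, Matrix.mul_assoc]

/-- With `T = Rᵀ R`, the product `S • T` is the trace of `R S Rᵀ`. -/
lemma frob_nonneg {S T : Matrix (Fin n) (Fin n) ℝ} (hS : S.PosSemidef) (hT : T.PosSemidef) :
    0 ≤ frob S T := by
  obtain ⟨R, rfl⟩ : ∃ R : Matrix (Fin n) (Fin n) ℝ, T = Rᴴ * R := by
    open scoped MatrixOrder in
    exact CStarAlgebra.nonneg_iff_eq_star_mul_self.1 (Matrix.nonneg_iff_posSemidef.2 hT)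
  rw [frob_eq_trace, Matrix.conjTranspose_eq_transpose_of_trivial, Matrix.transpose_mul,
    Matrix.transpose_transpose, ← Matrix.mul_assoc, Matrix.trace_mul_comm, ← Matrix.mul_assoc]
  simpa using (hS.mul_mul_conjTranspose_same R).trace_nonneg

/-- A quadratic form is bounded below by a multiple of the squared norm. -/
lemma exists_quadratic_lower_bound (M : Matrix (Fin n) (Fin n) ℝ) :
    ∃ C : ℝ, ∀ x : Fin n → ℝ, 0 ≤ C * (x ⬝ᵥ x) + x ⬝ᵥ M *ᵥ x := by
  refine ⟨∑ i, ∑ j, |M i j|, fun x => ?_⟩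
  have hx : ∀ i, x i * x i ≤ x ⬝ᵥ x := fun i =>
    Finset.single_le_sum (f := fun i => x i * x i) (fun j _ => mul_self_nonneg _)
      (Finset.mem_univ i)
  simp only [dotProduct, Matrix.mulVec] at hx ⊢
  rw [Finset.sum_mul, ← Finset.sum_add_distrib]
  refine Finset.sum_nonneg fun i _ => ?_
  rw [Finset.sum_mul, Finset.mul_sum, ← Finset.sum_add_distrib]
  refine Finset.sum_nonneg fun j _ => ?_
  have h1 : |x i * x j| ≤ ∑ i, x i * x i := by
    rw [abs_mul]
    nlinarith [hx i, hx j, abs_mul_abs_self (x i), abs_mul_abs_self (x j),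
      sq_nonneg (|x i| - |x j|)]
  have h2 : -(x i * (M i j * x j)) ≤ |M i j| * |x i * x j| := by
    rw [← abs_mul]
    refine le_trans (neg_le_abs _) (le_of_eq ?_)
    congr 1
    ring
  nlinarith [mul_le_mul_of_nonneg_left h1 (abs_nonneg (M i j))]

end Frobenius

/-! ### Block projections onto the first `r` and the last `n - r` coordinates -/

section Blocks

variable (n r : ℕ)

@[simp] lemma leadingId_transpose : (leadingId n r)ᵀ = leadingId n r := by simp [leadingId]

@[simp] lemma trailingId_transpose : (trailingId n r)ᵀ = trailingId n r := by simp [trailingId]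

@[simp] lemma leadingId_mul_self : leadingId n r * leadingId n r = leadingId n r := by
  simp [leadingId, Matrix.diagonal_mul_diagonal]

@[simp] lemma trailingId_mul_self : trailingId n r * trailingId n r = trailingId n r := by
  rw [trailingId, Matrix.diagonal_mul_diagonal]
  congr 1
  ext i
  split_ifs <;> simp

@[simp] lemma leadingId_mul_trailingId : leadingId n r * trailingId n r = 0 := by
  rw [leadingId, trailingId, Matrix.diagonal_mul_diagonal, ← Matrix.diagonal_zero]
  congr 1
  ext i
  split_ifs <;> simp

@[simp] lemma trailingId_mul_leadingId : trailingId n r * leadingId n r = 0 := by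
  rw [leadingId, trailingId, Matrix.diagonal_mul_diagonal, ← Matrix.diagonal_zero]
  congr 1
  ext i
  split_ifs <;> simp

lemma leadingId_add_trailingId : leadingId n r + trailingId n r = 1 := by
  rw [leadingId, trailingId, Matrix.diagonal_add, ← Matrix.diagonal_one]
  congr 1
  ext i
  split_ifs <;> simp

lemma posSemidef_leadingId : (leadingId n r).PosSemidef :=
  Matrix.PosSemidef.diagonal fun i => by dsimp only; split_ifs <;> simp

variable {n r}

lemma leadingId_mul_apply (M : Matrix (Fin n) (Fin n) ℝ) (i j : Fin n) :
    (leadingId n r * M) i j = if (i : ℕ) < r then M i j else 0 := by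
  simp [leadingId, Matrix.diagonal_mul]

lemma mul_leadingId_apply (M : Matrix (Fin n) (Fin n) ℝ) (i j : Fin n) :
    (M * leadingId n r) i j = if (j : ℕ) < r then M i j else 0 := by
  simp [leadingId, Matrix.mul_diagonal]

lemma trailingId_mul_apply (M : Matrix (Fin n) (Fin n) ℝ) (i j : Fin n) :
    (trailingId n r * M) i j = if (i : ℕ) < r then 0 else M i j := by
  simp [trailingId, Matrix.diagonal_mul]

lemma mul_trailingId_apply (M : Matrix (Fin n) (Fin n) ℝ) (i j : Fin n) :
    (M * trailingId n r) i j = if (j : ℕ) < r then 0 else M i j := by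
  simp [trailingId, Matrix.mul_diagonal]

lemma trailing_block_eq_zero_iff (M : Matrix (Fin n) (Fin n) ℝ) :
    trailingId n r * M * trailingId n r = 0 ↔
      ∀ i j : Fin n, r ≤ (i : ℕ) → r ≤ (j : ℕ) → M i j = 0 := by
  simp only [← Matrix.ext_iff, mul_trailingId_apply, trailingId_mul_apply, Matrix.zero_apply]
  refine forall₂_congr fun i j => ?_
  split_ifs <;> grind

lemma upper_right_block_eq_zero_iff (M : Matrix (Fin n) (Fin n) ℝ) :
    leadingId n r * M * trailingId n r = 0 ↔
      ∀ i j : Fin n, (i : ℕ) < r → r ≤ (j : ℕ) → M i j = 0 := by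
  simp only [← Matrix.ext_iff, mul_trailingId_apply, leadingId_mul_apply, Matrix.zero_apply]
  refine forall₂_congr fun i j => ?_
  split_ifs <;> grind

lemma eq_leading_add_trailing (M : Matrix (Fin n) (Fin n) ℝ) :
    M = leadingId n r * M + trailingId n r * M := by
  rw [← Matrix.add_mul, leadingId_add_trailingId, Matrix.one_mul]

lemma mul_trailingId_eq_zero_iff (M : Matrix (Fin n) (Fin n) ℝ) :
    M * trailingId n r = 0 ↔
      leadingId n r * M * trailingId n r = 0 ∧ trailingId n r * M * trailingId n r = 0 := by
  constructor
  · intro h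
    simp [Matrix.mul_assoc, h]
  · rintro ⟨h1, h2⟩
    rw [eq_leading_add_trailing (r := r) (M * trailingId n r), ← Matrix.mul_assoc,
      ← Matrix.mul_assoc, h1, h2, add_zero]

/-- A symmetric matrix annihilated by the trailing block lives on the leading block. -/
lemma leading_compress_eq {M : Matrix (Fin n) (Fin n) ℝ} (hM : M.IsSymm)
    (h : M * trailingId n r = 0) : leadingId n r * M * leadingId n r = M := by
  have h' : trailingId n r * M = 0 := by
    have := congrArg Matrix.transpose h
    simpa [Matrix.transpose_mul, hM.eq] using this
  have e1 : leadingId n r * M = M := by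
    conv_rhs => rw [eq_leading_add_trailing (r := r) M, h', add_zero]
  rw [e1]
  have : M * (leadingId n r + trailingId n r) = M := by
    rw [leadingId_add_trailingId, Matrix.mul_one]
  rwa [Matrix.mul_add, h, add_zero] at this

/-- A positive semidefinite matrix orthogonal to `I_r ⊕ 0` lives on the trailing block. -/
lemma trailing_compress_eq {Y : Matrix (Fin n) (Fin n) ℝ} (hY : Y.PosSemidef)
    (h : frob (leadingId n r) Y = 0) : trailingId n r * Y * trailingId n r = Y := by
  have hsum : frob (leadingId n r) Y = ∑ i : Fin n, if (i : ℕ) < r then Y i i else 0 := by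
    simp [frob, leadingId, Matrix.diagonal_apply]
  rw [hsum, Finset.sum_eq_zero_iff_of_nonneg
    (fun i _ => by split_ifs; exacts [hY.diag_nonneg, le_rfl])] at h
  -- A zero diagonal entry of a positive semidefinite matrix forces its column to vanish.
  have hcol : ∀ i j : Fin n, (j : ℕ) < r → Y i j = 0 := by
    intro i j hj
    have hjj := h j (Finset.mem_univ j)
    rw [if_pos hj] at hjj
    have := (hY.dotProduct_mulVec_zero_iff (Pi.single j 1)).1 (by simp [hjj])
    simpa using congrFun this i
  ext i j
  rw [mul_trailingId_apply, trailingId_mul_apply]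
  split_ifs with h1 h2
  · exact (hcol i j h1).symm
  · rw [← hY.isSymm.apply, hcol j i h2]
  · rfl

end Blocks

/-! ### Extending linear functionals, with and without positivity -/

section Extension

/-- A linear map vanishing on the kernel of `Φ` factors through `Φ`. -/
lemma LinearMap.exists_comp_of_ker_le {X E : Type*} [AddCommGroup X] [Module ℝ X]
    [AddCommGroup E] [Module ℝ E] (Φ : X →ₗ[ℝ] E) (φ : X →ₗ[ℝ] ℝ)
    (h : ∀ p, Φ p = 0 → φ p = 0) : ∃ g : E →ₗ[ℝ] ℝ, ∀ p, g (Φ p) = φ p := by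
  have hφ : φ ∈ (LinearMap.ker Φ).dualAnnihilator := by
    rw [Submodule.mem_dualAnnihilator]
    exact fun p hp => h p hp
  rw [← LinearMap.range_dualMap_eq_dualAnnihilator_ker] at hφ
  obtain ⟨g, hg⟩ := hφ
  exact ⟨g, fun p => by rw [← hg]; rfl⟩

/-- The M. Riesz extension theorem for a functional given through a linear parametrization. -/
lemma exists_nonneg_factorization {X E : Type*} [AddCommGroup X] [Module ℝ X]
    [AddCommGroup E] [Module ℝ E] (s : PointedCone ℝ E) (Φ : X →ₗ[ℝ] E) (φ : X →ₗ[ℝ] ℝ)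
    (nonneg : ∀ p, Φ p ∈ s → 0 ≤ φ p) (dense : ∀ y, ∃ p, Φ p + y ∈ s) :
    ∃ g : E →ₗ[ℝ] ℝ, (∀ p, g (Φ p) = φ p) ∧ ∀ y ∈ s, 0 ≤ g y := by
  -- If `Φ p = 0`, both `p` and `-p` map into the cone, so `φ p = 0`.
  obtain ⟨g₀, hg₀⟩ := Φ.exists_comp_of_ker_le φ fun p hp => by
    have h1 := nonneg p (by rw [hp]; exact s.zero_mem)
    have h2 := nonneg (-p) (by rw [map_neg, hp, neg_zero]; exact s.zero_mem)
    rw [map_neg] at h2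
    linarith
  obtain ⟨g, hg, hgs⟩ := riesz_extension s ⟨LinearMap.range Φ, g₀.domRestrict _⟩
    (by
      rintro ⟨_, p, rfl⟩ hp
      change 0 ≤ g₀ (Φ p)
      rw [hg₀]
      exact nonneg p hp)
    (fun y => by
      obtain ⟨p, hp⟩ := dense y
      exact ⟨⟨Φ p, p, rfl⟩, hp⟩)
  refine ⟨g, fun p => ?_, hgs⟩
  rw [← hg₀]
  exact hg ⟨Φ p, p, rfl⟩

end Extension

/-! ### A theorem of the alternative on the trailing block -/

section Gordan

variable {n : ℕ}

/-- Testing on `e_i ± e_j` gives `2 |M i j| ≤ M i i + M j j`. This bounds the spectraplex. -/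
lemma Matrix.PosSemidef.abs_apply_le_trace {M : Matrix (Fin n) (Fin n) ℝ} (hM : M.PosSemidef)
    (i j : Fin n) : |M i j| ≤ M.trace := by
  have hd : ∀ k, M k k ≤ M.trace := fun k =>
    Finset.single_le_sum (f := fun k => M k k) (fun k _ => hM.diag_nonneg) (Finset.mem_univ k)
  have hs : M j i = M i j := hM.isSymm.apply i j
  have h1 := (posSemidef_iff_real.1 hM).2 (Pi.single i 1 + Pi.single j 1)
  have h2 := (posSemidef_iff_real.1 hM).2 (Pi.single i 1 - Pi.single j 1)
  simp [Matrix.mulVec_add, Matrix.mulVec_sub] at h1 h2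
  rw [abs_le]
  constructor <;> linarith [hd i, hd j]

lemma dotProduct_self_pos {x : Fin n → ℝ} (hx : x ≠ 0) : 0 < x ⬝ᵥ x :=
  (Finset.sum_nonneg fun i _ => mul_self_nonneg (x i)).lt_of_ne'
    fun h => hx (dotProduct_self_eq_zero.1 h)

/-- The positive semidefinite matrices of trace one supported on the trailing block. -/
def trailingSpectraplex (n r : ℕ) : Set (Matrix (Fin n) (Fin n) ℝ) :=
  {M | M.PosSemidef ∧ M.trace = 1 ∧ trailingId n r * M * trailingId n r = M}

lemma convex_trailingSpectraplex (n r : ℕ) : Convex ℝ (trailingSpectraplex n r) := by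
  rintro M ⟨hM, hM1, hM2⟩ N ⟨hN, hN1, hN2⟩ a b ha hb hab
  refine ⟨(hM.smul ha).add (hN.smul hb), ?_, ?_⟩
  · simp [hM1, hN1, hab]
  · simp only [Matrix.mul_add, Matrix.add_mul, Matrix.mul_smul, Matrix.smul_mul, hM2, hN2]

lemma isCompact_trailingSpectraplex (n r : ℕ) : IsCompact (trailingSpectraplex n r) := by
  have hbox : IsCompact {M : Fin n → Fin n → ℝ | ∀ i j, M i j ∈ Set.Icc (-1 : ℝ) 1} := by
    have h : IsCompact (Set.univ.pi fun _ : Fin n => Set.univ.pi fun _ : Fin n =>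
        Set.Icc (-1 : ℝ) 1) :=
      isCompact_univ_pi fun _ => isCompact_univ_pi fun _ => isCompact_Icc
    convert h using 1
    ext M
    simp only [Set.mem_ofPred_eq, Set.mem_pi, Set.mem_univ, true_imp_iff]
  replace hbox : IsCompact {M : Matrix (Fin n) (Fin n) ℝ | ∀ i j, M i j ∈ Set.Icc (-1 : ℝ) 1} :=
    hbox
  refine hbox.of_isClosed_subset ?_ ?_
  · have h : trailingSpectraplex n r = ({M | Mᵀ = M} ∩ ⋂ x : Fin n → ℝ, {M | 0 ≤ x ⬝ᵥ M *ᵥ x}) ∩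
        ({M | M.trace = 1} ∩ {M | trailingId n r * M * trailingId n r = M}) := by
      ext M
      simp [trailingSpectraplex, posSemidef_iff_real, Matrix.IsSymm]
    rw [h]
    refine ((isClosed_eq (by fun_prop) (by fun_prop)).inter
      (isClosed_iInter fun x => isClosed_le (by fun_prop) (by fun_prop))).inter
      ((isClosed_eq (by fun_prop) (by fun_prop)).inter (isClosed_eq (by fun_prop) (by fun_prop)))
  · rintro M ⟨hM, hM1, -⟩ i j
    have := hM.abs_apply_le_trace i j
    rw [hM1] at this
    exact abs_le.1 this

/-- If a subspace of symmetric matrices contains no matrix with a nonzero positive semidefinite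
trailing block, it is orthogonal to a matrix that is positive definite on the trailing block. -/
theorem exists_trailing_posDef_orthogonal (r : ℕ) (N : Submodule ℝ (Matrix (Fin n) (Fin n) ℝ))
    (hsymm : ∀ V ∈ N, V.IsSymm)
    (hN : ∀ V ∈ N, (trailingId n r * V * trailingId n r).PosSemidef →
      trailingId n r * V * trailingId n r = 0) :
    ∃ H : Matrix (Fin n) (Fin n) ℝ, trailingId n r * H * trailingId n r = H ∧
      (leadingId n r + H).PosDef ∧ ∀ V ∈ N, frob V H = 0 := by
  have : LocallyConvexSpace ℝ (Matrix (Fin n) (Fin n) ℝ) :=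
    inferInstanceAs (LocallyConvexSpace ℝ (Fin n → Fin n → ℝ))
  let c : Matrix (Fin n) (Fin n) ℝ →ₗ[ℝ] Matrix (Fin n) (Fin n) ℝ :=
    { toFun := fun M => trailingId n r * M * trailingId n r
      map_add' := fun M M' => by simp [Matrix.mul_add, Matrix.add_mul]
      map_smul' := fun a M => by simp }
  have hdisj : Disjoint (trailingSpectraplex n r) (N.map c : Set (Matrix (Fin n) (Fin n) ℝ)) := by
    rw [Set.disjoint_left]
    rintro _ ⟨hM, hM1, -⟩ ⟨V, hV, rfl⟩
    have h0 : c V = 0 := hN V hV hM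
    simp [h0] at hM1
  obtain ⟨f, u, v, hfu, huv, hvf⟩ := geometric_hahn_banach_compact_closed
    (convex_trailingSpectraplex n r) (isCompact_trailingSpectraplex n r)
    (N.map c).convex (N.map c).closed_of_finiteDimensional hdisj
  have hv0 : v < 0 := by simpa using hvf 0 (N.map c).zero_mem
  -- A functional bounded below on a subspace vanishes there: otherwise some multiple of `V` would
  -- take exactly the value `v`.
  have hf0 : ∀ V ∈ N.map c, f V = 0 := by
    intro V hV
    by_contra hne
    have := hvf ((v / f V) • V) ((N.map c).smul_mem _ hV)
    rw [map_smul, smul_eq_mul, div_mul_cancel₀ _ hne] at this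
    exact lt_irrefl _ this
  obtain ⟨G, hGs, hG⟩ := exists_isSymm_frob_eq (-f.toLinearMap)
  have hcomp : ∀ M : Matrix (Fin n) (Fin n) ℝ,
      frob M (trailingId n r * G * trailingId n r) = frob (c M) G := by
    intro M
    simp [c, frob_mul_mul_left]
  -- For `y = F x ≠ 0`, the normalized `y yᵀ` lies in the spectraplex, where `f < 0`; `G` represents
  -- `-f`.
  have hpos : ∀ x : Fin n → ℝ, trailingId n r *ᵥ x ≠ 0 →
      0 < x ⬝ᵥ (trailingId n r * G * trailingId n r) *ᵥ x := by
    intro x hx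
    set y := trailingId n r *ᵥ x with hy
    have hyv : c (Matrix.vecMulVec x x) = Matrix.vecMulVec y y := by
      simp only [c, LinearMap.coe_mk, AddHom.coe_mk, Matrix.mul_vecMulVec, Matrix.vecMulVec_mul, hy]
      rw [← Matrix.mulVec_transpose, trailingId_transpose]
    have hyps : (Matrix.vecMulVec y y).PosSemidef := by
      simpa using Matrix.posSemidef_vecMulVec_self_star y
    have hypos := dotProduct_self_pos hx
    have hmem : (y ⬝ᵥ y)⁻¹ • Matrix.vecMulVec y y ∈ trailingSpectraplex n r := by
      refine ⟨hyps.smul (inv_nonneg.2 hypos.le), ?_, ?_⟩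
      · simp [Matrix.trace_vecMulVec, inv_mul_cancel₀ hypos.ne']
      · rw [← hyv]
        simp [c, Matrix.mul_assoc, ← Matrix.mul_assoc (trailingId n r) (trailingId n r)]
    have hlt := (hfu _ hmem).trans (huv.trans hv0)
    rw [map_smul, smul_eq_mul] at hlt
    have hfy : f (Matrix.vecMulVec y y) < 0 := by
      by_contra hcon
      exact absurd hlt (not_lt.2 (mul_nonneg (inv_nonneg.2 hypos.le) (not_lt.1 hcon)))
    rw [← frob_vecMulVec, hcomp, hyv, ← hG _ hyps.isSymm]
    simpa using hfy
  refine ⟨trailingId n r * G * trailingId n r, ?_, ?_, fun V hV => ?_⟩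
  · simp [Matrix.mul_assoc, ← Matrix.mul_assoc (trailingId n r) (trailingId n r)]
  · refine Matrix.PosDef.of_dotProduct_mulVec_pos ?_ fun x hx => ?_
    · simp [Matrix.IsHermitian, Matrix.transpose_mul, hGs.eq, Matrix.mul_assoc]
    · rw [star_trivial, Matrix.add_mulVec, dotProduct_add]
      have hE := (posSemidef_iff_real.1 (posSemidef_leadingId n r)).2 x
      by_cases hFx : trailingId n r *ᵥ x = 0
      · have hEx : leadingId n r *ᵥ x = x := by
          have h := congrArg (· *ᵥ x) (leadingId_add_trailingId n r)
          simpa [Matrix.add_mulVec, hFx] using h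
        rw [← Matrix.mulVec_mulVec, hFx, Matrix.mulVec_zero, dotProduct_zero, add_zero, hEx]
        exact dotProduct_self_pos hx
      · exact add_pos_of_nonneg_of_pos hE (hpos x hFx)
  · have hVs : (c V).IsSymm := by
      simp [c, Matrix.IsSymm, Matrix.transpose_mul, (hsymm V hV).eq, Matrix.mul_assoc]
    rw [hcomp, ← hG _ hVs]
    simpa using hf0 _ (Submodule.mem_map_of_mem hV)

/-- A matrix on the trailing block that is positive definite there is `Q (0 ⊕ I) Qᵀ` for a
trailing rotation `Q`. -/
theorem exists_trailingRotation_eq {r : ℕ} {H : Matrix (Fin n) (Fin n) ℝ}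
    (hH : trailingId n r * H * trailingId n r = H) (hpd : (leadingId n r + H).PosDef) :
    ∃ Q : Matrix (Fin n) (Fin n) ℝ, IsTrailingRotation r Q ∧ Q * trailingId n r * Qᵀ = H := by
  have hHF : trailingId n r * H = H := by
    rw [← hH]
    simp [← Matrix.mul_assoc]
  have hHps : H.PosSemidef := by
    have := hpd.posSemidef.rotate (trailingId n r)
    simpa [rotate, Matrix.mul_add, Matrix.add_mul, hH] using this
  -- The rotation will be `E + √H`: its square `E + H` is positive definite, so it is invertible.
  obtain ⟨R, hRs, hRR⟩ : ∃ R : Matrix (Fin n) (Fin n) ℝ, R.IsSymm ∧ R * R = H := by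
    open scoped MatrixOrder in
    exact ⟨CFC.sqrt H, (Matrix.nonneg_iff_posSemidef.1 (CFC.sqrt_nonneg H)).isSymm,
      CFC.sqrt_mul_sqrt_self H (Matrix.nonneg_iff_posSemidef.2 hHps)⟩
  have hER : leadingId n r * R = 0 := by
    have h : leadingId n r * R * (leadingId n r * R)ᴴ = 0 := by
      rw [Matrix.conjTranspose_eq_transpose_of_trivial, Matrix.transpose_mul, hRs.eq,
        Matrix.mul_assoc, ← Matrix.mul_assoc R, hRR, ← hHF]
      simp [← Matrix.mul_assoc]
    exact Matrix.self_mul_conjTranspose_eq_zero.1 h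
  have hRE : R * leadingId n r = 0 := by
    have := congrArg Matrix.transpose hER
    simpa [Matrix.transpose_mul, hRs.eq] using this
  have hRF : R * trailingId n r = R := by
    have h : R * (leadingId n r + trailingId n r) = R := by
      rw [leadingId_add_trailingId, Matrix.mul_one]
    rwa [Matrix.mul_add, hRE, zero_add] at h
  refine ⟨leadingId n r + R, ⟨?_, fun i j hij => ?_⟩, ?_⟩
  · have hsq : (leadingId n r + R) * (leadingId n r + R) = leadingId n r + H := by
      simp [Matrix.mul_add, Matrix.add_mul, hER, hRE, hRR]
    exact isUnit_of_mul_isUnit_left (hsq ▸ hpd.isUnit)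
  · have hRij : R i j = 0 := by
      rcases hij with h | h
      · simpa [leadingId_mul_apply, h] using congrFun (congrFun hER i) j
      · simpa [mul_leadingId_apply, h] using congrFun (congrFun hRE i) j
    rw [Matrix.add_apply, hRij, add_zero, leadingId, Matrix.diagonal_apply, Matrix.one_apply]
    rcases eq_or_ne i j with rfl | hne
    · rw [or_self] at hij
      simp [hij]
    · simp [hne]
  · rw [Matrix.add_mul, leadingId_mul_trailingId, zero_add, hRF, Matrix.transpose_add, hRs.eq,
      leadingId_transpose, Matrix.mul_add, hRE, zero_add, hRR]

end Gordan

/-! ### Invariance under rotation -/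

section Rotation

variable {m n : ℕ}

lemma rotate_rotate (T Q M : Matrix (Fin n) (Fin n) ℝ) :
    rotate Q (rotate T M) = rotate (T * Q) M := by
  simp [rotate, Matrix.transpose_mul, Matrix.mul_assoc]

lemma rotate_one (M : Matrix (Fin n) (Fin n) ℝ) : rotate 1 M = M := by simp [rotate]

lemma dotProduct_rotate_mulVec (P M : Matrix (Fin n) (Fin n) ℝ) (y : Fin n → ℝ) :
    y ⬝ᵥ rotate P M *ᵥ y = (P *ᵥ y) ⬝ᵥ M *ᵥ (P *ᵥ y) := by
  rw [rotate, ← Matrix.mulVec_mulVec, ← Matrix.mulVec_mulVec, Matrix.dotProduct_mulVec,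
    Matrix.vecMul_transpose]

/-- Rotation by a fixed matrix, as a linear map. -/
def rotateLin (T : Matrix (Fin n) (Fin n) ℝ) :
    Matrix (Fin n) (Fin n) ℝ →ₗ[ℝ] Matrix (Fin n) (Fin n) ℝ where
  toFun := rotate T
  map_add' M N := by simp [rotate, Matrix.mul_add, Matrix.add_mul]
  map_smul' a M := by simp [rotate]

lemma slackAt_rotate (T : Matrix (Fin n) (Fin n) ℝ) (A : Fin m → Matrix (Fin n) (Fin n) ℝ)
    (B : Matrix (Fin n) (Fin n) ℝ) (x : Fin m → ℝ) :
    slackAt (fun i => rotate T (A i)) (rotate T B) x = rotate T (slackAt A B x) := by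
  change _ = rotateLin T _
  simp only [slackAt, map_sub, map_sum, map_smul]
  rfl

variable {T : Matrix (Fin n) (Fin n) ℝ}

lemma rotate_inv_rotate (hT : IsUnit T) (M : Matrix (Fin n) (Fin n) ℝ) :
    rotate T⁻¹ (rotate T M) = M := by
  rw [rotate_rotate, Matrix.mul_nonsing_inv _ ((Matrix.isUnit_iff_isUnit_det _).1 hT), rotate_one]

lemma isUnit_inv (hT : IsUnit T) : IsUnit T⁻¹ := Matrix.isUnit_nonsing_inv_iff.2 hT

lemma posSemidef_rotate_iff (hT : IsUnit T) {M : Matrix (Fin n) (Fin n) ℝ} :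
    (rotate T M).PosSemidef ↔ M.PosSemidef :=
  ⟨fun h => by simpa [rotate_inv_rotate hT] using h.rotate T⁻¹, fun h => h.rotate T⟩

lemma rank_rotate (hT : IsUnit T) (M : Matrix (Fin n) (Fin n) ℝ) :
    (rotate T M).rank = M.rank := by
  have hdet := (Matrix.isUnit_iff_isUnit_det _).1 hT
  rw [rotate, Matrix.rank_mul_eq_left_of_isUnit_det _ _ hdet,
    Matrix.rank_mul_eq_right_of_isUnit_det _ _ (by rwa [Matrix.det_transpose])]

lemma sdSystem_rotate (hT : IsUnit T) (A : Fin m → Matrix (Fin n) (Fin n) ℝ)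
    (B : Matrix (Fin n) (Fin n) ℝ) :
    sdSystem (fun i => rotate T (A i)) (rotate T B) = sdSystem A B := by
  ext x
  change (slackAt _ _ x).PosSemidef ↔ (slackAt _ _ x).PosSemidef
  rw [slackAt_rotate, posSemidef_rotate_iff hT]

/-- Feasible sets agree, and a dual solution `Y` of the rotated system becomes `T Y Tᵀ`. -/
lemma WellBehaved.of_rotate (hT : IsUnit T) {A : Fin m → Matrix (Fin n) (Fin n) ℝ}
    {B : Matrix (Fin n) (Fin n) ℝ}
    (h : WellBehaved (fun i => rotate T (A i)) (rotate T B)) : WellBehaved A B := by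
  intro c v hv
  rw [← sdSystem_rotate hT] at hv
  obtain ⟨Y, hY, hYA, hYB⟩ := h c v hv
  refine ⟨T * Y * Tᵀ, ?_, fun i => ?_, ?_⟩
  · simpa using hY.mul_mul_conjTranspose_same T
  · rw [← frob_rotate, hYA]
  · rw [← frob_rotate, hYB]

lemma wellBehaved_rotate_iff (hT : IsUnit T) (A : Fin m → Matrix (Fin n) (Fin n) ℝ)
    (B : Matrix (Fin n) (Fin n) ℝ) :
    WellBehaved (fun i => rotate T (A i)) (rotate T B) ↔ WellBehaved A B :=
  ⟨fun h => h.of_rotate hT, fun h => WellBehaved.of_rotate (isUnit_inv hT)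
    (by simpa only [rotate_inv_rotate hT] using h)⟩

lemma IsMaxRankSlack.rotate (hT : IsUnit T) {A : Fin m → Matrix (Fin n) (Fin n) ℝ}
    {B Z : Matrix (Fin n) (Fin n) ℝ} (h : IsMaxRankSlack A B Z) :
    IsMaxRankSlack (fun i => rotate T (A i)) (rotate T B) (rotate T Z) := by
  obtain ⟨⟨x, hx, hxZ⟩, hmax⟩ := h
  unfold IsMaxRankSlack
  simp only [sdSystem_rotate hT, slackAt_rotate, rank_rotate hT]
  exact ⟨⟨x, hx, by rw [hxZ]⟩, hmax⟩

/-- Hence a trailing rotation preserves the normal form of the maximum rank slack. -/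
lemma IsTrailingRotation.rotate_leadingId {r : ℕ} {Q : Matrix (Fin n) (Fin n) ℝ}
    (hQ : IsTrailingRotation r Q) : rotate Q (leadingId n r) = leadingId n r := by
  have h : leadingId n r * Q = leadingId n r := by
    ext i j
    rw [leadingId_mul_apply]
    split_ifs with hi
    · rw [hQ.2 i j (Or.inl hi), leadingId, Matrix.diagonal_apply, Matrix.one_apply, if_pos hi]
    · simp [leadingId, Matrix.diagonal_apply, hi]
  have h' : Qᵀ * leadingId n r = leadingId n r := by
    simpa [Matrix.transpose_mul] using congrArg Matrix.transpose h
  rw [rotate, h', h]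

end Rotation

/-! ### Maximum rank slacks and dual certificates -/

section MaxRankSlack

variable {m n : ℕ} {A : Fin m → Matrix (Fin n) (Fin n) ℝ} {B : Matrix (Fin n) (Fin n) ℝ} {r : ℕ}

lemma slackAt_eq (A : Fin m → Matrix (Fin n) (Fin n) ℝ) (B : Matrix (Fin n) (Fin n) ℝ)
    (x : Fin m → ℝ) : slackAt A B x = B - Fintype.linearCombination ℝ A x := rfl

lemma isSymm_linearCombination (hA : ∀ i, (A i).IsSymm) (x : Fin m → ℝ) :
    (Fintype.linearCombination ℝ A x).IsSymm := by
  simp [Fintype.linearCombination_apply, Matrix.IsSymm, Matrix.transpose_sum, (hA _).eq]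

/-- The kernel of a maximum rank slack is contained in the kernel of every slack, because the
kernel of a sum of positive semidefinite matrices is the intersection of their kernels. -/
lemma IsMaxRankSlack.slackAt_mul_trailingId (hmax : IsMaxRankSlack A B (leadingId n r))
    {x : Fin m → ℝ} (hx : x ∈ sdSystem A B) : slackAt A B x * trailingId n r = 0 := by
  obtain ⟨⟨z, -, hz⟩, hrank⟩ := hmax
  have hS : (slackAt A B x).PosSemidef := hx
  have hE := posSemidef_leadingId n r
  set P := (1 / 2 : ℝ) • leadingId n r + (1 / 2 : ℝ) • slackAt A B x with hP
  have hPps : P.PosSemidef := (hE.smul (by norm_num)).add (hS.smul (by norm_num))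
  have hmid : slackAt A B ((1 / 2 : ℝ) • z + (1 / 2 : ℝ) • x) = P := by
    rw [hP, ← hz]
    simp only [slackAt_eq, map_add, map_smul]
    module
  have hPr : P.rank ≤ (leadingId n r).rank := by
    rw [← hmid]
    refine hrank _ ?_
    change (slackAt A B _).PosSemidef
    rwa [hmid]
  have hker : ∀ y, P *ᵥ y = 0 → leadingId n r *ᵥ y = 0 ∧ slackAt A B x *ᵥ y = 0 := by
    intro y hy
    have h1 := hE.dotProduct_mulVec_nonneg y
    have h2 := hS.dotProduct_mulVec_nonneg y
    have h3 : star y ⬝ᵥ P *ᵥ y = 0 := by rw [hy, dotProduct_zero]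
    rw [hP, Matrix.add_mulVec, Matrix.smul_mulVec, Matrix.smul_mulVec, dotProduct_add,
      dotProduct_smul, dotProduct_smul, smul_eq_mul, smul_eq_mul] at h3
    exact ⟨(hE.dotProduct_mulVec_zero_iff y).1 (by linarith),
      (hS.dotProduct_mulVec_zero_iff y).1 (by linarith)⟩
  have hle : LinearMap.ker P.mulVecLin ≤ LinearMap.ker (leadingId n r).mulVecLin :=
    fun y hy => (hker y hy).1
  -- The rank bound on the midpoint slack `P` turns the inclusion of kernels into equality.
  have heq : LinearMap.ker P.mulVecLin = LinearMap.ker (leadingId n r).mulVecLin := by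
    refine Submodule.eq_of_le_of_finrank_le hle ?_
    have h1 := P.mulVecLin.finrank_range_add_finrank_ker
    have h2 := (leadingId n r).mulVecLin.finrank_range_add_finrank_ker
    unfold Matrix.rank at hPr
    omega
  refine Matrix.toLin'.injective (LinearMap.ext fun y => ?_)
  rw [map_zero, LinearMap.zero_apply, Matrix.toLin'_apply]
  rw [← Matrix.mulVec_mulVec]
  have hmem : trailingId n r *ᵥ y ∈ LinearMap.ker P.mulVecLin := by
    rw [heq, LinearMap.mem_ker, Matrix.mulVecLin_apply, Matrix.mulVec_mulVec]
    simp
  exact (hker _ hmem).2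

/-- In a well-behaved system a combination of the `A_i` with positive semidefinite trailing block
has vanishing trailing columns. -/
theorem WellBehaved.linearCombination_mul_trailingId (hwb : WellBehaved A B)
    (hmax : IsMaxRankSlack A B (leadingId n r)) {x : Fin m → ℝ}
    (hps : (trailingId n r * Fintype.linearCombination ℝ A x * trailingId n r).PosSemidef) :
    Fintype.linearCombination ℝ A x * trailingId n r = 0 := by
  by_contra hne
  obtain ⟨⟨z, hz, hzE⟩, -⟩ := id hmax
  set K : Submodule ℝ (Fin m → ℝ) :=
    LinearMap.ker (LinearMap.mulRight ℝ (trailingId n r) ∘ₗ Fintype.linearCombination ℝ A) with hK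
  obtain ⟨l, hlx, hlK⟩ := Submodule.exists_le_ker_of_notMem (p := K) (v := x) hne
  let g : (Fin m → ℝ) →ₗ[ℝ] ℝ := (-(l x)⁻¹) • l
  have hgx : g x = -1 := by simp [g, hlx]
  have hgK : ∀ y ∈ K, g y = 0 := fun y hy => by
    have : l y = 0 := hlK hy
    simp [g, this]
  have hg : ∀ y, g y = ∑ i, g (Pi.single i 1) * y i := by
    intro y
    conv_lhs => rw [← Finset.univ_sum_single y]
    rw [map_sum]
    refine Finset.sum_congr rfl fun i _ => ?_
    rw [mul_comm, ← smul_eq_mul, ← map_smul, ← Pi.single_smul', smul_eq_mul, mul_one]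
  -- All slacks have zero trailing columns, so feasible points differ by elements of `K`.
  have hconst : ∀ y ∈ sdSystem A B, g y = g z := by
    intro y hy
    have hmem : y - z ∈ K := by
      have h1 := hmax.slackAt_mul_trailingId hy
      have h2 := hmax.slackAt_mul_trailingId hz
      change Fintype.linearCombination ℝ A (y - z) * trailingId n r = 0
      have h3 : Fintype.linearCombination ℝ A (y - z) = slackAt A B z - slackAt A B y := by
        rw [slackAt_eq, slackAt_eq, map_sub]
        abel
      rw [h3, Matrix.sub_mul, h1, h2, sub_zero]
    have := hgK _ hmem
    rw [map_sub] at this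
    linarith
  obtain ⟨Y, hY, hYA, hYB⟩ := hwb (fun i => g (Pi.single i 1)) (g z) (by
    constructor
    · rintro _ ⟨y, hy, rfl⟩
      dsimp only
      rw [← hg, hconst y hy]
    · intro b hb
      rw [hg]
      exact hb ⟨z, hz, rfl⟩)
  have hYc : ∀ y, frob (Fintype.linearCombination ℝ A y) Y = g y := by
    intro y
    rw [hg, ← frobLin_apply, Fintype.linearCombination_apply, map_sum]
    refine Finset.sum_congr rfl fun i _ => ?_
    rw [map_smul, frobLin_apply, hYA, smul_eq_mul, mul_comm]
  have hYE : frob (leadingId n r) Y = 0 := by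
    rw [← hzE, slackAt_eq, frob_sub_left, hYB, hYc, sub_self]
  have hYF := trailing_compress_eq hY hYE
  have hnn := frob_nonneg hps hY
  rw [frob_mul_mul_left, trailingId_transpose, hYF, hYc, hgx] at hnn
  linarith

/-! ### Strong duality on the leading block, and sufficiency -/

/-- The matrices whose leading block has a nonnegative quadratic form. -/
def leadingCone (n r : ℕ) : PointedCone ℝ (Matrix (Fin n) (Fin n) ℝ) where
  carrier := {M | ∀ y : Fin n → ℝ, 0 ≤ (leadingId n r *ᵥ y) ⬝ᵥ M *ᵥ (leadingId n r *ᵥ y)}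
  zero_mem' := by simp
  add_mem' {M N} hM hN y := by
    simpa only [Matrix.add_mulVec, dotProduct_add] using add_nonneg (hM y) (hN y)
  smul_mem' a M hM y := by
    have h : a • M = (a : ℝ) • M := rfl
    rw [h, Matrix.smul_mulVec, dotProduct_smul]
    exact mul_nonneg a.2 (hM y)

/-- The cone demands no symmetry, so that adding a multiple of `E` can bring any matrix into it, as
the extension theorem requires. -/
lemma mem_leadingCone_iff {M : Matrix (Fin n) (Fin n) ℝ} (hM : M.IsSymm) :
    M ∈ leadingCone n r ↔ (leadingId n r * M * leadingId n r).PosSemidef := by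
  have h : leadingId n r * M * leadingId n r = rotate (leadingId n r) M := by simp [rotate]
  rw [h, posSemidef_iff_real, and_iff_right (hM.rotate _)]
  simp only [dotProduct_rotate_mulVec]
  rfl

lemma exists_smul_leadingId_add_mem_leadingCone (r : ℕ) (M : Matrix (Fin n) (Fin n) ℝ) :
    ∃ C : ℝ, C • leadingId n r + M ∈ leadingCone n r := by
  obtain ⟨C, hC⟩ := exists_quadratic_lower_bound M
  refine ⟨C, fun y => ?_⟩
  rw [Matrix.add_mulVec, Matrix.smul_mulVec, Matrix.mulVec_mulVec, leadingId_mul_self,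
    dotProduct_add, dotProduct_smul]
  exact hC _

/-- Dual attainment on the leading block: if the affine slice `I_r ⊕ 0 - L x` has a Slater point
and `l` has supremum `v` over its positive semidefinite members, then `l` is represented by a
positive semidefinite matrix `Y` with `Y • (I_r ⊕ 0) = v`. -/
theorem exists_leading_dual_solution {X : Type*} [AddCommGroup X] [Module ℝ X]
    (L : X →ₗ[ℝ] Matrix (Fin n) (Fin n) ℝ) (hsymm : ∀ x, (L x).IsSymm)
    (hlead : ∀ x, leadingId n r * L x * leadingId n r = L x) (l : X →ₗ[ℝ] ℝ) {v : ℝ}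
    (hv : IsLUB (l '' {x | (leadingId n r - L x).PosSemidef}) v) :
    ∃ Y : Matrix (Fin n) (Fin n) ℝ, Y.PosSemidef ∧ (∀ x, frob (L x) Y = l x) ∧
      frob (leadingId n r) Y = v := by
  let Φ : X × ℝ →ₗ[ℝ] Matrix (Fin n) (Fin n) ℝ :=
    (LinearMap.toSpanSingleton ℝ _ (leadingId n r)) ∘ₗ LinearMap.snd ℝ X ℝ -
      L ∘ₗ LinearMap.fst ℝ X ℝ
  let φ : X × ℝ →ₗ[ℝ] ℝ :=
    (LinearMap.toSpanSingleton ℝ _ v) ∘ₗ LinearMap.snd ℝ X ℝ - l ∘ₗ LinearMap.fst ℝ X ℝ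
  have hΦ : ∀ x t, Φ (x, t) = t • leadingId n r - L x := fun x t => rfl
  have hφ : ∀ x t, φ (x, t) = t * v - l x := fun x t => rfl
  have hEs : (leadingId n r).IsSymm := leadingId_transpose n r
  have hΦs : ∀ x t, (Φ (x, t)).IsSymm := fun x t => by
    rw [hΦ]
    exact (hEs.smul t).sub (hsymm x)
  have hΦE : ∀ x t, leadingId n r * Φ (x, t) * leadingId n r = Φ (x, t) := fun x t => by
    rw [hΦ, Matrix.mul_sub, Matrix.sub_mul, hlead]
    simp
  have hfeas : ∀ x, (leadingId n r - L x).PosSemidef → l x ≤ v :=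
    fun x hx => hv.1 ⟨x, hx, rfl⟩
  obtain ⟨g, hgΦ, hg⟩ := exists_nonneg_factorization (leadingCone n r) Φ φ
    (by
      rintro ⟨x, t⟩ hp
      rw [mem_leadingCone_iff (hΦs x t), hΦE, hΦ] at hp
      rw [hφ, sub_nonneg]
      -- The claim is `l x ≤ t v`. For `t < 1`, the point `x + (1 - t) z` is feasible for every
      -- feasible `z`; take the supremum over `z`. For `t ≥ 1`, rescale by `t⁻¹`.
      rcases lt_or_ge t 1 with ht | ht
      · have hle : v ≤ (v - l x) / (1 - t) := by
          refine hv.2 ?_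
          rintro _ ⟨z, hz, rfl⟩
          rw [le_div_iff₀ (by linarith)]
          have h := hfeas (x + (1 - t) • z) (by
            have h : leadingId n r - L (x + (1 - t) • z) =
                (1 - t) • (leadingId n r - L z) + (t • leadingId n r - L x) := by
              rw [map_add, map_smul]
              module
            rw [h]
            exact (hz.smul (by linarith)).add hp)
          rw [map_add, map_smul, smul_eq_mul] at h
          linarith
        rw [le_div_iff₀ (by linarith)] at hle
        linarith
      · have ht0 : 0 < t := by linarith
        have h := hfeas (t⁻¹ • x) (by
          have h : leadingId n r - L (t⁻¹ • x) = t⁻¹ • (t • leadingId n r - L x) := by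
            rw [map_smul, smul_sub, smul_smul, inv_mul_cancel₀ ht0.ne', one_smul]
          rw [h]
          exact hp.smul (inv_nonneg.2 ht0.le))
        rwa [map_smul, smul_eq_mul, inv_mul_le_iff₀ ht0] at h)
    (fun M => by
      obtain ⟨C, hC⟩ := exists_smul_leadingId_add_mem_leadingCone r M
      exact ⟨(0, C), by rwa [hΦ, map_zero, sub_zero]⟩)
  obtain ⟨G, hGs, hG⟩ := exists_isSymm_frob_eq g
  have hpair : ∀ M, M.IsSymm → leadingId n r * M * leadingId n r = M →
      frob M (leadingId n r * G * leadingId n r) = g M := by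
    intro M hM hME
    rw [hG M hM]
    conv_rhs => rw [← hME]
    rw [frob_mul_mul_left, leadingId_transpose]
  refine ⟨leadingId n r * G * leadingId n r, posSemidef_iff_real.2 ⟨?_, fun y => ?_⟩,
    fun x => ?_, ?_⟩
  · simp [Matrix.IsSymm, Matrix.transpose_mul, hGs.eq, Matrix.mul_assoc]
  · have hps : (Matrix.vecMulVec y y).PosSemidef := by
      simpa using Matrix.posSemidef_vecMulVec_self_star y
    have hps2 := hps.rotate (leadingId n r)
    rw [rotate, leadingId_transpose] at hps2
    have hmem : leadingId n r * Matrix.vecMulVec y y * leadingId n r ∈ leadingCone n r := by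
      rw [mem_leadingCone_iff hps2.isSymm]
      simpa [rotate] using hps2.rotate (leadingId n r)
    have h := hg _ hmem
    rwa [hG _ hps2.isSymm, frob_mul_mul_left, leadingId_transpose, frob_vecMulVec] at h
  · have h := hgΦ (-x, 0)
    rw [hΦ, hφ, zero_smul, zero_sub, ← map_neg, neg_neg, zero_mul, zero_sub,
      ← map_neg, neg_neg] at h
    rw [hpair _ (hsymm x) (hlead x), h]
  · have h := hgΦ (0, 1)
    rw [hΦ, hφ, map_zero, map_zero, sub_zero, sub_zero, one_smul, one_mul] at h
    rw [hpair _ hEs (by simp), h]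

/-- The two conditions are sufficient for good behaviour. -/
theorem wellBehaved_of_orthogonality_of_block (hA : ∀ i, (A i).IsSymm)
    (hmax : IsMaxRankSlack A B (leadingId n r)) (hO : OrthogonalityCondition r A B)
    (hblk : BlockCondition r A B) : WellBehaved A B := by
  intro c v hv
  obtain ⟨⟨z, hz, hzE⟩, -⟩ := id hmax
  set L := Fintype.linearCombination ℝ A with hL
  have hB : B = leadingId n r + L z := by
    rw [← hzE, slackAt_eq, sub_add_cancel]
  have hLs := isSymm_linearCombination hA
  have hLspan : ∀ x, L x ∈ Submodule.span ℝ (insert B (Set.range A)) := by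
    intro x
    rw [hL, Fintype.linearCombination_apply]
    exact Submodule.sum_mem _ fun i _ => Submodule.smul_mem _ _
      (Submodule.subset_span (Set.mem_insert_of_mem _ ⟨i, rfl⟩))
  let D : (Fin m → ℝ) →ₗ[ℝ] Matrix (Fin n) (Fin n) ℝ :=
    LinearMap.mulRight ℝ (trailingId n r) ∘ₗ LinearMap.mulLeft ℝ (trailingId n r) ∘ₗ L
  have hD : ∀ x, D x = trailingId n r * L x * trailingId n r := fun x => rfl
  let l : (Fin m → ℝ) →ₗ[ℝ] ℝ := Fintype.linearCombination ℝ c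
  have hl : ∀ x, l x = ∑ i, c i * x i := fun x => by
    simp [l, Fintype.linearCombination_apply, mul_comm]
  have hker : ∀ x, D x = 0 → L x * trailingId n r = 0 := fun x hx => by
    rw [mul_trailingId_eq_zero_iff]
    refine ⟨?_, hx⟩
    rw [upper_right_block_eq_zero_iff]
    exact hblk _ (hLspan x) ((trailing_block_eq_zero_iff _).1 hx)
  have hslack : ∀ x, slackAt A B (x + z) = leadingId n r - L x := fun x => by
    rw [slackAt_eq, ← hL, hB, map_add]
    abel
  -- Translation by `z` identifies the original problem with the reduced one on `ker D`.
  have hlub : IsLUB ((l.domRestrict (LinearMap.ker D)) '' {x | (leadingId n r -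
      L.domRestrict (LinearMap.ker D) x).PosSemidef}) (v - l z) := by
    constructor
    · rintro _ ⟨⟨x, hx⟩, hps, rfl⟩
      have h : l (x + z) ≤ v := by
        refine hv.1 ⟨x + z, ?_, (hl _).symm⟩
        change (slackAt A B (x + z)).PosSemidef
        rw [hslack]
        exact hps
      rw [map_add] at h
      change l x ≤ v - l z
      linarith
    · intro b hb
      suffices h : v ≤ b + l z by linarith
      refine hv.2 ?_
      rintro _ ⟨y, hy, rfl⟩
      have hyz : slackAt A B y = leadingId n r - L (y - z) := by
        rw [← hslack, sub_add_cancel]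
      have hmem : y - z ∈ LinearMap.ker D := by
        have h := hmax.slackAt_mul_trailingId hy
        rw [hyz, Matrix.sub_mul, leadingId_mul_trailingId, zero_sub, neg_eq_zero] at h
        rw [LinearMap.mem_ker, hD, Matrix.mul_assoc, h, Matrix.mul_zero]
      have hps : (slackAt A B y).PosSemidef := hy
      have h : l (y - z) ≤ b := hb ⟨⟨y - z, hmem⟩, by rwa [hyz] at hps, rfl⟩
      rw [map_sub] at h
      dsimp only
      rw [← hl]
      linarith
  obtain ⟨Y, hY, hYl, hYv⟩ := exists_leading_dual_solution
    (L.domRestrict (LinearMap.ker D)) (fun x => hLs x)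
    (fun x => leading_compress_eq (hLs x) (hker x x.2)) _ hlub
  -- `Y` represents `l` only on `ker D`; the defect is therefore a functional of the trailing block.
  obtain ⟨g, hg⟩ := D.exists_comp_of_ker_le (l - frobLin Y ∘ₗ L) fun x hx => by
    have h := hYl ⟨x, hx⟩
    change frob (L x) Y = l x at h
    simp [h]
  obtain ⟨G, hGs, hG⟩ := exists_isSymm_frob_eq g
  obtain ⟨C, hC⟩ := exists_quadratic_lower_bound G
  have hLF : ∀ x, frob (L x) (trailingId n r) = 0 := by
    intro x
    rw [← frobLin_apply, hL, Fintype.linearCombination_apply, map_sum]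
    exact Finset.sum_eq_zero fun i _ => by rw [map_smul, frobLin_apply, hO.1, smul_zero]
  -- The shift by `C • 1` restores semidefiniteness; `hLF` makes it invisible to every `L x`.
  have hps : (trailingId n r * (G + C • 1) * trailingId n r).PosSemidef := by
    have h : (G + C • 1).PosSemidef := by
      refine posSemidef_iff_real.2 ⟨hGs.add (Matrix.isSymm_one.smul C), fun x => ?_⟩
      rw [Matrix.add_mulVec, Matrix.smul_mulVec, Matrix.one_mulVec, dotProduct_add,
        dotProduct_smul, add_comm]
      exact hC x
    simpa [rotate] using h.rotate (trailingId n r)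
  have hYc : ∀ x, frob (L x) (Y + trailingId n r * (G + C • 1) * trailingId n r) = l x := by
    intro x
    have hDs : (D x).IsSymm := by
      simpa [hD, rotate] using (hLs x).rotate (trailingId n r)
    have h := hg x
    rw [hG _ hDs, hD, frob_mul_mul_left, trailingId_transpose] at h
    simp only [LinearMap.sub_apply, LinearMap.comp_apply, frobLin_apply] at h
    rw [Matrix.mul_add, Matrix.add_mul, frob_add_right, frob_add_right, h]
    simp [frob_smul_right, hLF]
  refine ⟨Y + trailingId n r * (G + C • 1) * trailingId n r, hY.add hps, fun i => ?_, ?_⟩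
  · have h := hYc (Pi.single i 1)
    rw [hl, hL, Fintype.linearCombination_apply_single, one_smul] at h
    rw [h]
    simp [Pi.single_apply]
  · rw [hB, frob_add_left, hYc, frob_add_right, hYv, frob_comm, frob_mul_mul_left]
    simp [frob_comm _ (0 : Matrix (Fin n) (Fin n) ℝ), frob_zero_left]

/-! ### Necessity of the two conditions -/

/-- The block condition is necessary for good behaviour. -/
theorem WellBehaved.blockCondition (hwb : WellBehaved A B)
    (hmax : IsMaxRankSlack A B (leadingId n r)) : BlockCondition r A B := by
  obtain ⟨⟨z, -, hzE⟩, -⟩ := id hmax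
  intro V hV hV22
  rw [← trailing_block_eq_zero_iff] at hV22
  rw [← upper_right_block_eq_zero_iff]
  obtain ⟨a, W, hW, rfl⟩ := Submodule.mem_span_insert.1 hV
  obtain ⟨w, rfl⟩ := (Submodule.mem_span_range_iff_exists_fun ℝ).1 hW
  -- Trading `B` for `E + L z` leaves a multiple of `E`, which has no trailing columns.
  have hV : a • B + ∑ i, w i • A i =
      a • leadingId n r + Fintype.linearCombination ℝ A (a • z + w) := by
    rw [← hzE, slackAt_eq, map_add, map_smul, ← Fintype.linearCombination_apply]
    module
  rw [hV] at hV22 ⊢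
  have h22 : trailingId n r * Fintype.linearCombination ℝ A (a • z + w) * trailingId n r = 0 := by
    simpa [Matrix.mul_add, Matrix.add_mul] using hV22
  have h := hwb.linearCombination_mul_trailingId hmax (h22 ▸ Matrix.PosSemidef.zero)
  rw [Matrix.mul_assoc, Matrix.add_mul, h]
  simp

/-- After a suitable trailing rotation a well-behaved system satisfies the orthogonality
condition. -/
theorem WellBehaved.exists_trailingRotation_orthogonality (hwb : WellBehaved A B)
    (hA : ∀ i, (A i).IsSymm) (hmax : IsMaxRankSlack A B (leadingId n r)) :
    ∃ Q : Matrix (Fin n) (Fin n) ℝ, IsTrailingRotation r Q ∧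
      OrthogonalityCondition r (fun i => rotate Q (A i)) (rotate Q B) := by
  obtain ⟨H, hHF, hpd, hH⟩ := exists_trailing_posDef_orthogonal r
    (LinearMap.range (Fintype.linearCombination ℝ A))
    (by
      rintro _ ⟨x, rfl⟩
      exact isSymm_linearCombination hA x)
    (by
      rintro _ ⟨x, rfl⟩ hps
      rw [Matrix.mul_assoc, hwb.linearCombination_mul_trailingId hmax hps, Matrix.mul_zero])
  obtain ⟨Q, hQ, hQH⟩ := exists_trailingRotation_eq hHF hpd
  obtain ⟨⟨z, -, hzE⟩, -⟩ := id hmax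
  refine ⟨Q, hQ, fun i => ?_, ?_⟩
  · rw [frob_rotate, hQH]
    exact hH _ ⟨Pi.single i 1, by simp⟩
  · have hB : B = leadingId n r + Fintype.linearCombination ℝ A z := by
      rw [← hzE, slackAt_eq, sub_add_cancel]
    rw [frob_rotate, hQH, hB, frob_add_left, hH _ ⟨z, rfl⟩, ← hHF, frob_comm, frob_mul_mul_left]
    simp [frob_comm _ (0 : Matrix (Fin n) (Fin n) ℝ), frob_zero_left]

end MaxRankSlack

/-! ### Existence of the normal form -/

section Existence

variable {m n : ℕ}

/-- A positive semidefinite matrix is congruent to some `I_r ⊕ 0`. -/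
theorem Matrix.PosSemidef.exists_rotate_eq_leadingId {Z : Matrix (Fin n) (Fin n) ℝ}
    (hZ : Z.PosSemidef) :
    ∃ r ≤ n, ∃ T : Matrix (Fin n) (Fin n) ℝ, IsUnit T ∧ _root_.rotate T Z = leadingId n r := by
  set ev := hZ.isHermitian.eigenvalues
  let O : Matrix (Fin n) (Fin n) ℝ := hZ.isHermitian.eigenvectorUnitary
  have hO : IsUnit O := (Unitary.toUnits hZ.isHermitian.eigenvectorUnitary).isUnit
  have hOZ : _root_.rotate O Z = Matrix.diagonal ev := by
    have h := hZ.isHermitian.conjStarAlgAut_star_eigenvectorUnitary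
    rw [Unitary.conjStarAlgAut_star_apply] at h
    exact h
  let r := Fintype.card {i // ev i ≠ 0}
  have hr : r ≤ n := (Fintype.card_subtype_le _).trans_eq (Fintype.card_fin n)
  let e : {i : Fin n // (i : ℕ) < r} ≃ {i // ev i ≠ 0} :=
    Fintype.equivOfCardEq (by
      rw [Fintype.card_subtype, Fin.card_filter_val_lt, min_eq_right hr])
  -- A permutation moving the nonzero eigenvalues to the first `r` positions.
  let σ : Equiv.Perm (Fin n) := e.extendSubtype
  have hσ : ∀ i : Fin n, ev (σ i) ≠ 0 ↔ (i : ℕ) < r := fun i =>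
    ⟨fun h => by_contra fun hi => e.extendSubtype_not_mem i hi h, e.extendSubtype_mem i⟩
  -- The value `1` at zero eigenvalues keeps the scaling invertible.
  let d : Fin n → ℝ := fun i => if ev i ≠ 0 then (Real.sqrt (ev i))⁻¹ else 1
  have hev : ∀ i, ev i ≠ 0 → Real.sqrt (ev i) ≠ 0 := fun i hi =>
    (Real.sqrt_pos.2 ((hZ.eigenvalues_nonneg i).lt_of_ne' hi)).ne'
  have hd : ∀ i, d i ≠ 0 := fun i => by
    by_cases h : ev i ≠ 0
    · simpa [d, h] using hev i h
    · simp [d, not_not.1 h]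
  have hdd : ∀ i, d i * ev i * d i = if ev i ≠ 0 then 1 else 0 := fun i => by
    by_cases h : ev i ≠ 0
    · have h1 := Real.mul_self_sqrt (hZ.eigenvalues_nonneg i)
      simp only [d, if_pos h]
      field_simp [hev i h]
      rw [sq, h1]
    · simp [d, not_not.1 h]
  have hDu : IsUnit (Matrix.diagonal d) := by
    rw [Matrix.isUnit_iff_isUnit_det, Matrix.det_diagonal, isUnit_iff_ne_zero]
    exact Finset.prod_ne_zero_iff.2 fun i _ => hd i
  refine ⟨r, hr, (O * Matrix.diagonal d).submatrix (Equiv.refl _) σ,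
    (Matrix.isUnit_submatrix_equiv _ _).2 (hO.mul hDu), ?_⟩
  have h : _root_.rotate (O * Matrix.diagonal d) Z =
      Matrix.diagonal fun i => d i * ev i * d i := by
    rw [← rotate_rotate, hOZ, _root_.rotate, Matrix.diagonal_transpose,
      Matrix.diagonal_mul_diagonal, Matrix.diagonal_mul_diagonal]
  have h' : _root_.rotate ((O * Matrix.diagonal d).submatrix (Equiv.refl _) σ) Z =
      (_root_.rotate (O * Matrix.diagonal d) Z).submatrix σ σ := by
    ext i j
    simp [_root_.rotate, Matrix.mul_apply]
  rw [h', h, Matrix.submatrix_diagonal_equiv, leadingId]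
  congr 1
  ext i
  simp only [Function.comp_apply, hdd, hσ]

/-- A nonempty system has a slack of maximum rank. -/
lemma exists_isMaxRankSlack {A : Fin m → Matrix (Fin n) (Fin n) ℝ}
    {B : Matrix (Fin n) (Fin n) ℝ} (hne : (sdSystem A B).Nonempty) :
    ∃ x ∈ sdSystem A B, IsMaxRankSlack A B (slackAt A B x) := by
  have hfin : ((fun x => (slackAt A B x).rank) '' sdSystem A B).Finite := by
    refine (Set.finite_Iic n).subset ?_
    rintro _ ⟨x, -, rfl⟩
    simpa using (slackAt A B x).rank_le_width
  obtain ⟨_, ⟨x, hx, rfl⟩, hmax⟩ := hfin.exists_maximal (hne.image _)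
  refine ⟨x, hx, ⟨x, hx, rfl⟩, fun y hy => ?_⟩
  exact (le_total _ _).elim id fun h => hmax ⟨y, hy, rfl⟩ h

end Existence

/-! ### The characterization of well-behaved systems -/

theorem theorem1p2 {m n : ℕ} (A : Fin m → Matrix (Fin n) (Fin n) ℝ)
    (B : Matrix (Fin n) (Fin n) ℝ) (hA : ∀ i, (A i).IsSymm) (hB : B.IsSymm)
    (hne : (sdSystem A B).Nonempty) :
    (∃ r ≤ n, ∃ T : Matrix (Fin n) (Fin n) ℝ, IsUnit T ∧
      IsMaxRankSlack (fun i => rotate T (A i)) (rotate T B) (leadingId n r)) ∧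
    ∀ r ≤ n, ∀ T : Matrix (Fin n) (Fin n) ℝ, IsUnit T →
      IsMaxRankSlack (fun i => rotate T (A i)) (rotate T B) (leadingId n r) →
      (WellBehaved A B ↔
        ∃ Q : Matrix (Fin n) (Fin n) ℝ, IsTrailingRotation r Q ∧
          OrthogonalityCondition r (fun i => rotate (T * Q) (A i)) (rotate (T * Q) B) ∧
          BlockCondition r (fun i => rotate (T * Q) (A i)) (rotate (T * Q) B)) := by
  constructor
  · obtain ⟨x, hx, hmax⟩ := exists_isMaxRankSlack hne
    obtain ⟨r, hr, T, hT, hTZ⟩ := Matrix.PosSemidef.exists_rotate_eq_leadingId hx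
    exact ⟨r, hr, T, hT, hTZ ▸ hmax.rotate hT⟩
  · intro r _ T hT hmax
    have hsymm : ∀ Q i, (rotate Q (rotate T (A i))).IsSymm := fun Q i => ((hA i).rotate T).rotate Q
    rw [← wellBehaved_rotate_iff hT]
    simp only [← rotate_rotate]
    constructor
    · intro hwb
      obtain ⟨Q, hQ, hO⟩ := hwb.exists_trailingRotation_orthogonality (fun i => (hA i).rotate T) hmax
      refine ⟨Q, hQ, hO, ?_⟩
      -- The block condition is needed after rotation by `Q`, where `E` is still a maximum rank
      -- slack.
      have hmaxQ := hmax.rotate hQ.1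
      rw [hQ.rotate_leadingId] at hmaxQ
      exact ((wellBehaved_rotate_iff hQ.1 _ _).2 hwb).blockCondition hmaxQ
    · rintro ⟨Q, hQ, hO, hblk⟩
      have hmaxQ := hmax.rotate hQ.1
      rw [hQ.rotate_leadingId] at hmaxQ
      exact (wellBehaved_rotate_iff hQ.1 _ _).1
        (wellBehaved_of_orthogonality_of_block (hsymm Q) hmaxQ hO hblk)
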